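/- Let $T$ be the vertex set of a rooted tree with root $x_0$, let $T_n$ be the set of vertices at level $n$, and let $S(x)\subset T_{n+1}$ be the set of children of $x\in T_n$; every $T_n$ is finite and every $S(x)$ has at least two elements. Let $q(x,y)\ge 0$ be weights on $T\times T$ with $q(x,y)>0$ if and only if $y\in S(x)$, and $\sum_{y\in S(x)}q(x,y)=1$ for all $x\in T$. Let $\partial T$ be the set of infinite paths $e=(z_0,z_1,\dots)$ with $z_0=x_0$ and $z_{n+1}\in S(z_n)$ for all $n$, equipped with the $\sigma$-algebra generated by the sets $B_x=\{e: e \text{ passes through } x\}$, $x\in T$, and with the unique probability measure $\mathbb P$ such that $\mathbb P(B_x)=\prod_{j<n}q(y_j,y_{j+1})$ for $x \in T_n$, where $y_0=x_0,\dots,y_n=x$ is the path from the root to $x$. Let $\mathbb F$ be a field with a topology and let $E$ be a vector space over $\mathbb F$ with a translation invariant metric $d$ that makes it separable (completeness is not assumed) and such that scalar multiplication $\mathbb F\times E\to E$ is continuous. Let $L^0=L^0(\partial T,E)$ be the space of measurable functions $\partial T\to E$ modulo $\mathbb P$-almost everywhere equality, with the metric $d_{\mathbb P}(h,g)=\int_{\partial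 T}\frac{d(h,g)}{1+d(h,g)}\,d\mathbb P$ of convergence in probability. Let $w(x,y)\in\mathbb F\setminus\{0\}$ be given for $x\in T$, $y\in S(x)$, and let $H(T,E)$ be the vector space of the functions $f:T\to E$ with $f(x)=\sum_{y\in S(x)}w(x,y)f(y)$ for all $x\in T$ (generalized harmonic functions), with the topology induced by the product topology of $E^T$. For $f:T\to E$ and $n\ge 0$ let $\omega_n(f)\in L^0$ be the function $e=(z_0,z_1,\dots)\mapsto f(z_n)$. Let $U_{FM}(T,E)$ be the set of $f\in H(T,E)$ such that for every non-empty open $V\subset L^0$ the set $\{n:\omega_n(f)\in V\}$ has strictly positive lower density. Let $X(T,E)$ be the set of $f\in H(T,E)$ such that for every non-empty open $V\subset L^0$ the set $\{n:\omega_n(f)\in V\}$ has upper density $1$. Then: 1. $U_{FM}(T,E)$ is dense in $H(T,E)$. 2. If $\sum_{y\in S(x)}w(x,y)=1$ for all $x\in T$, then $U_{FM}(T,E)\cup\{0\}$ contains a vector subspace of $H(T,E)$ that is dense in $H(T,E)$. 3. If $\sum_{y\in S(x)}w(x,y)=1$ for all $x\in T$, then $X(T,E)$ is a dense $G_\delta$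 subset of $H(T,E)$; if moreover $E\ne\{0\}$, then $U_{FM}(T,E)\cap X(T,E)=\emptyset$. -/

import Mathlib

open MeasureTheory Filter Topology

noncomputable section

namespace TreeHarmonic

/-! ### Rooted trees -/

/-- A rooted tree with vertex set `T`, given by its root, its levels and the finite sets of
children. `T_n` is the set of vertices `x` with `level x = n`; `T_0 = {root}`, the sets
`children x`, for `x` in `T_n`, form a partition of `T_{n+1}`, and every vertex has at least
two children. All the levels are finite (`RootedTree.finite_level`). -/
structure RootedTree (T : Type*) where
  /-- the root `x_0` -/
  root : T
  /-- the level of a vertex -/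
  level : T → ℕ
  /-- the set `S(x)` of children of `x` -/
  children : T → Finset T
  level_eq_zero_iff : ∀ x, level x = 0 ↔ x = root
  level_of_mem_children : ∀ x, ∀ y ∈ children x, level y = level x + 1
  existsUnique_parent : ∀ y, y ≠ root → ∃! x, y ∈ children x
  two_le_card_children : ∀ x, 2 ≤ (children x).card

variable {T : Type*} (G : RootedTree T)

theorem RootedTree.finite_level (n : ℕ) : {x | G.level x = n}.Finite := by
  induction n with
  | zero =>
    refine (Set.finite_singleton G.root).subset fun x hx => ?_
    exact (G.level_eq_zero_iff x).1 hx
  | succ n ih =>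
    refine (ih.biUnion fun x _ => (G.children x).finite_toSet).subset fun y hy => ?_
    have hy0 : y ≠ G.root := fun h => by
      have := (G.level_eq_zero_iff y).2 h
      simp only [Set.mem_ofPred_eq] at hy
      omega
    obtain ⟨x, hx, -⟩ := G.existsUnique_parent y hy0
    have := G.level_of_mem_children x y hx
    simp only [Set.mem_ofPred_eq] at hy
    simp only [Set.mem_ofPred_eq, Set.mem_iUnion]
    exact ⟨x, by omega, hx⟩

theorem RootedTree.countable {T : Type*} (G : RootedTree T) : Countable T := by
  have h : (⋃ n, {x | G.level x = n}) = Set.univ := by ext x; simp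
  exact Set.countable_univ_iff.1 (h ▸ Set.countable_iUnion fun n => (G.finite_level n).countable)

/-- The boundary `∂T`: the infinite geodesics `e = (z_0, z_1, …)` starting at the root. -/
structure RootedTree.Boundary where
  /-- the unique vertex `z_n` of level `n` on the geodesic -/
  vertex : ℕ → T
  vertex_zero : vertex 0 = G.root
  vertex_succ_mem : ∀ n, vertex (n + 1) ∈ G.children (vertex n)

variable {G}

theorem RootedTree.Boundary.level_vertex (e : G.Boundary) (n : ℕ) : G.level (e.vertex n) = n := by
  induction n with
  | zero => exact (G.level_eq_zero_iff _).2 e.vertex_zero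
  | succ n ih => exact (G.level_of_mem_children _ _ (e.vertex_succ_mem n)).trans (congrArg (· + 1) ih)

/-- The boundary sector `B_x`: the geodesics that pass through `x`. -/
def RootedTree.sector (G : RootedTree T) (x : T) : Set G.Boundary := {e | ∃ n, e.vertex n = x}

theorem RootedTree.mem_sector_iff {x : T} {e : G.Boundary} :
    e ∈ G.sector x ↔ e.vertex (G.level x) = x := by
  refine ⟨?_, fun h => ⟨_, h⟩⟩
  rintro ⟨n, rfl⟩
  rw [e.level_vertex]

/-- The σ-algebra `M` on `∂T`, generated by all the boundary sectors. -/
instance : MeasurableSpace G.Boundary :=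
  MeasurableSpace.generateFrom (Set.range G.sector)

/-! ### The probability measure on the boundary -/

/-- Probability weights `q(x, y) ≥ 0`, positive exactly when `y` is a child of `x`,
with `∑_{y ∈ S(x)} q(x, y) = 1`. -/
structure Weights (G : RootedTree T) where
  /-- the weight of a pair of vertices -/
  q : T → T → ℝ
  nonneg : ∀ x y, 0 ≤ q x y
  pos_iff : ∀ x y, 0 < q x y ↔ y ∈ G.children x
  sum_eq_one : ∀ x, ∑ y ∈ G.children x, q x y = 1

/-- The type of the children of `x`, with all its subsets measurable. -/
structure RootedTree.Child (G : RootedTree T) (x : T) where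
  /-- the child as a vertex of the tree -/
  val : T
  mem : val ∈ G.children x

instance (x : T) : MeasurableSpace (G.Child x) := ⊤

instance (x : T) : MeasurableSingletonClass (G.Child x) := ⟨fun _ => trivial⟩

/-- The law of the step of the random walk from `x`: the child `y` has probability `q(x, y)`. -/
def Weights.stepMeasure (Q : Weights G) (x : T) : Measure (G.Child x) :=
  ∑ y ∈ (G.children x).attach, ENNReal.ofReal (Q.q x y) • Measure.dirac (α := G.Child x) ⟨y.1, y.2⟩

theorem Weights.stepMeasure_singleton (Q : Weights G) (x : T) (y : T) (hy : y ∈ G.children x) :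
    Q.stepMeasure x {c | c.val = y} = ENNReal.ofReal (Q.q x y) := by
  classical
  have hm : MeasurableSet {c : G.Child x | c.val = y} := trivial
  simp only [Weights.stepMeasure, Measure.coe_finsetSum, Finset.sum_apply, Measure.smul_apply,
    smul_eq_mul, Measure.dirac_apply' _ hm]
  rw [Finset.sum_eq_single (⟨y, hy⟩ : {z // z ∈ G.children x})]
  · simp
  · intro z _ hz
    have : z.1 ≠ y := fun h => hz (Subtype.ext h)
    simp [this]
  · intro h
    exact absurd (Finset.mem_attach _ _) h

instance (Q : Weights G) (x : T) : IsProbabilityMeasure (Q.stepMeasure x) := by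
  refine ⟨?_⟩
  simp only [Weights.stepMeasure, Measure.coe_finsetSum, Finset.sum_apply, Measure.smul_apply,
    smul_eq_mul, measure_univ, mul_one]
  rw [Finset.sum_attach (G.children x) (fun y => ENNReal.ofReal (Q.q x y)),
    ← ENNReal.ofReal_sum_of_nonneg fun y _ => Q.nonneg x y, Q.sum_eq_one, ENNReal.ofReal_one]

/-- The geodesic obtained from a choice of one child for every vertex. -/
def RootedTree.pathAux (G : RootedTree T) (c : ∀ x, G.Child x) : ℕ → T
  | 0 => G.root
  | n + 1 => (c (G.pathAux c n)).1

/-- The geodesic obtained from a choice of one child for every vertex, as a boundary point. -/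
def RootedTree.path (G : RootedTree T) (c : ∀ x, G.Child x) : G.Boundary :=
  ⟨G.pathAux c, rfl, fun n => (c (G.pathAux c n)).2⟩

/-- The probability measure `ℙ` on `∂T`: the law of the geodesic that leaves every vertex `x`
towards a child drawn with the weights `q(x, ·)`, independently for distinct vertices. It is
the unique probability measure on `M` with `ℙ(B_x) = ∏_{j<n} q(y_j, y_{j+1})`
for `x` in `T_n`, where `y_0, …, y_n = x` is the path from the root to `x`
(`Weights.boundaryMeasure_sector`). -/
def Weights.boundaryMeasure (Q : Weights G) : Measure G.Boundary :=
  (Measure.infinitePi Q.stepMeasure).map G.path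

theorem RootedTree.measurableSet_pathAux (n : ℕ) (x : T) :
    MeasurableSet {c : ∀ x, G.Child x | G.pathAux c n = x} := by
  have := G.countable
  induction n generalizing x with
  | zero => exact MeasurableSet.const (G.root = x)
  | succ n ih =>
    have h : {c : ∀ x, G.Child x | G.pathAux c (n + 1) = x} =
        ⋃ y, ({c | G.pathAux c n = y} ∩ (fun c => c y) ⁻¹' {d | d.val = x}) := by
      ext c
      simp [RootedTree.pathAux]
    rw [h]
    refine MeasurableSet.iUnion fun y => (ih y).inter ?_
    exact measurable_pi_apply y trivial

theorem RootedTree.measurable_path : Measurable G.path := by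
  refine measurable_generateFrom ?_
  rintro _ ⟨x, rfl⟩
  have h : G.path ⁻¹' G.sector x = {c | G.pathAux c (G.level x) = x} := by
    ext c
    rw [Set.mem_preimage, RootedTree.mem_sector_iff]
    rfl
  rw [h]
  exact RootedTree.measurableSet_pathAux _ _

theorem RootedTree.measurableSet_sector (x : T) : MeasurableSet (G.sector x) :=
  MeasurableSpace.measurableSet_generateFrom ⟨x, rfl⟩

instance (Q : Weights G) : IsProbabilityMeasure Q.boundaryMeasure :=
  Measure.isProbabilityMeasure_map RootedTree.measurable_path.aemeasurable

/-- `ℙ(B_x)` is the product of the weights along the path from the root to `x`. -/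
theorem Weights.boundaryMeasure_sector (Q : Weights G) (e : G.Boundary) (n : ℕ) :
    Q.boundaryMeasure (G.sector (e.vertex n)) =
      ENNReal.ofReal (∏ j ∈ Finset.range n, Q.q (e.vertex j) (e.vertex (j + 1))) := by
  classical
  have hinj : Function.Injective e.vertex := fun a b h => by
    rw [← e.level_vertex a, h, e.level_vertex]
  have hset : G.path ⁻¹' G.sector (e.vertex n) =
      Set.pi ((Finset.range n).image e.vertex : Finset T)
        (fun x => {c : G.Child x | c.val = e.vertex (G.level x + 1)}) := by
    ext c
    rw [Set.mem_preimage, RootedTree.mem_sector_iff, e.level_vertex]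
    simp only [Finset.coe_image, Finset.coe_range, Set.mem_pi, Set.mem_image, Set.mem_Iio,
      Set.mem_ofPred_eq, forall_exists_index, and_imp, forall_apply_eq_imp_iff₂, e.level_vertex]
    change G.pathAux c n = e.vertex n ↔ _
    induction n with
    | zero => simp only [not_lt_zero, false_imp_iff, implies_true, iff_true]; exact e.vertex_zero.symm
    | succ n ih =>
      constructor
      · intro h
        have hn : G.pathAux c n = e.vertex n := by
          by_cases h0 : e.vertex (n + 1) = G.root
          · have h1 := (G.level_eq_zero_iff _).2 h0
            rw [e.level_vertex] at h1
            omega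
          · obtain ⟨z, -, hz⟩ := G.existsUnique_parent _ h0
            have h1 := hz (e.vertex n) (e.vertex_succ_mem n)
            have h2 := hz (G.pathAux c n) (h ▸ (c (G.pathAux c n)).2)
            exact h2.trans h1.symm
        intro j hj
        rcases Nat.lt_succ_iff_lt_or_eq.1 hj with hj | rfl
        · exact ih.1 hn j hj
        · rw [← h, ← hn]; rfl
      · intro h
        have hn := ih.2 fun j hj => h j (by omega)
        rw [← h n (by omega), ← hn]; rfl
  rw [Weights.boundaryMeasure,
    Measure.map_apply RootedTree.measurable_path (RootedTree.measurableSet_sector _), hset,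
    Measure.infinitePi_pi _ (fun x _ => show MeasurableSet[⊤] _ from trivial), Finset.prod_image fun a _ b _ h => hinj h,
    ENNReal.ofReal_prod_of_nonneg fun _ _ => Q.nonneg _ _]
  refine Finset.prod_congr rfl fun j _ => ?_
  rw [e.level_vertex]
  exact Q.stepMeasure_singleton _ _ (e.vertex_succ_mem j)

/-! ### The space `L⁰(∂T, E)` -/

/-- `L⁰(∂T, E)`: measurable functions `∂T → E` modulo equality `ℙ`-almost everywhere. -/
abbrev L0 (Q : Weights G) (E : Type*) [TopologicalSpace E] : Type _ :=
  G.Boundary →ₘ[Q.boundaryMeasure] E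

variable {E : Type*}

section Metric

variable [MetricSpace E]

/-- The bounded metric `d(a, b) / (1 + d(a, b))` on `E`. -/
def bdist (a b : E) : ℝ := dist a b / (1 + dist a b)

theorem bdist_nonneg (a b : E) : 0 ≤ bdist a b := by unfold bdist; positivity

theorem bdist_le_one (a b : E) : bdist a b ≤ 1 := by
  unfold bdist
  rw [div_le_one (by positivity)]
  linarith

theorem bdist_comm (a b : E) : bdist a b = bdist b a := by simp only [bdist, dist_comm]

theorem bdist_eq_zero {a b : E} : bdist a b = 0 ↔ a = b := by
  have h : (1 + dist a b) ≠ 0 := by positivity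
  simp [bdist, h]

theorem bdist_triangle (a b c : E) : bdist a c ≤ bdist a b + bdist b c := by
  unfold bdist
  have hx : 0 ≤ dist a b := dist_nonneg
  have hy : 0 ≤ dist b c := dist_nonneg
  have hz : 0 ≤ dist a c := dist_nonneg
  have ht := dist_triangle a b c
  generalize dist a b = x at *
  generalize dist b c = y at *
  generalize dist a c = z at *
  have h1 : z / (1 + z) ≤ (x + y) / (1 + (x + y)) := by
    rw [div_le_div_iff₀ (by positivity) (by positivity)]; nlinarith
  have h2 : x / (1 + (x + y)) ≤ x / (1 + x) := by gcongr; linarith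
  have h3 : y / (1 + (x + y)) ≤ y / (1 + y) := by gcongr; linarith
  rw [add_div] at h1
  linarith

variable {Q : Weights G}

theorem L0.integrable_bdist (h g : L0 Q E) :
    Integrable (fun e => bdist (h e) (g e)) Q.boundaryMeasure := by
  have hc : Continuous fun p : E × E => bdist p.1 p.2 := by
    unfold bdist
    refine Continuous.div (by fun_prop) (by fun_prop) fun p => ?_
    positivity
  have hm : AEStronglyMeasurable (fun e => bdist (h e) (g e)) Q.boundaryMeasure :=
    hc.comp_aestronglyMeasurable
      ((AEEqFun.aestronglyMeasurable h).prodMk (AEEqFun.aestronglyMeasurable g))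
  refine Integrable.of_bound hm 1 (Eventually.of_forall fun e => ?_)
  rw [Real.norm_of_nonneg (bdist_nonneg _ _)]
  exact bdist_le_one _ _

/-- `L⁰(∂T, E)` with the metric
`d_ℙ(h, g) = ∫ d(h(e), g(e)) / (1 + d(h(e), g(e))) dℙ(e)` of convergence in probability. -/
instance : MetricSpace (L0 Q E) where
  dist h g := ∫ e, bdist (h e) (g e) ∂Q.boundaryMeasure
  dist_self h := by simp [bdist_eq_zero.2 rfl]
  dist_comm h g := by simp only [bdist_comm]
  dist_triangle h g k := by
    rw [← integral_add (L0.integrable_bdist h g) (L0.integrable_bdist g k)]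
    exact integral_mono (L0.integrable_bdist h k)
      ((L0.integrable_bdist h g).add (L0.integrable_bdist g k)) fun e => bdist_triangle _ _ _
  eq_of_dist_eq_zero := by
    intro h g hd
    refine AEEqFun.ext ?_
    have := (integral_eq_zero_iff_of_nonneg (fun _ => bdist_nonneg _ _)
      (L0.integrable_bdist h g)).1 hd
    filter_upwards [this] with e he
    exact bdist_eq_zero.1 he

end Metric

section Omega

variable [TopologicalSpace E]

theorem stronglyMeasurable_vertex (f : T → E) (n : ℕ) :
    StronglyMeasurable fun e : G.Boundary => f (e.vertex n) := by
  have := G.countable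
  let _ : MeasurableSpace T := ⊤
  have hv : Measurable fun e : G.Boundary => e.vertex n := by
    refine measurable_to_countable' fun x => ?_
    by_cases hx : G.level x = n
    · have : (fun e : G.Boundary => e.vertex n) ⁻¹' {x} = G.sector x := by
        ext e; rw [RootedTree.mem_sector_iff, hx]; rfl
      rw [this]
      exact RootedTree.measurableSet_sector x
    · have : (fun e : G.Boundary => e.vertex n) ⁻¹' {x} = ∅ := by
        ext e
        simp only [Set.mem_preimage, Set.mem_singleton_iff, Set.mem_empty_iff_false, iff_false]
        rintro rfl
        exact hx (e.level_vertex n)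
      rw [this]
      exact MeasurableSet.empty
  exact (StronglyMeasurable.of_discrete (f := f)).comp_measurable hv

/-- `ω_n(f)`: the (class of the) function on `∂T` whose value at `e` is `f(z)`, where `z` is the
vertex of level `n` on `e`. -/
def omega (Q : Weights G) (n : ℕ) (f : T → E) : L0 Q E :=
  AEEqFun.mk (fun e : G.Boundary => f (e.vertex n))
    (stronglyMeasurable_vertex f n).aestronglyMeasurable

end Omega

/-! ### Generalized harmonic functions -/

/-- `H(T, E)`: the vector space of the functions `f : T → E` with
`f(x) = ∑_{y ∈ S(x)} w(x, y) f(y)` for every vertex `x`. It carries the subspace topology of the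
product `E^T`. -/
def harmonic {𝔽 : Type*} [Field 𝔽] (G : RootedTree T) (w : T → T → 𝔽) (E : Type*)
    [AddCommGroup E] [Module 𝔽 E] : Submodule 𝔽 (T → E) where
  carrier := {f | ∀ x, f x = ∑ y ∈ G.children x, w x y • f y}
  add_mem' := by
    intro f g hf hg x
    simp only [Pi.add_apply, smul_add, Finset.sum_add_distrib]
    rw [hf x, hg x]
  zero_mem' := by intro x; simp
  smul_mem' := by
    intro c f hf x
    simp only [Pi.smul_apply]
    rw [hf x, Finset.smul_sum]
    exact Finset.sum_congr rfl fun y _ => smul_comm _ _ _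

/-- The lower density `liminf_n |A ∩ {0, …, n}| / (n + 1)` of a set of natural numbers. -/
def lowerDensity (A : Set ℕ) : ℝ :=
  liminf (fun n : ℕ => ((A ∩ Set.Iic n).ncard : ℝ) / (n + 1)) atTop

/-- The upper density `limsup_n |A ∩ {0, …, n}| / (n + 1)` of a set of natural numbers. -/
def upperDensity (A : Set ℕ) : ℝ :=
  limsup (fun n : ℕ => ((A ∩ Set.Iic n).ncard : ℝ) / (n + 1)) atTop

section Universal

variable {𝔽 : Type*} [Field 𝔽] (Q : Weights G) (w : T → T → 𝔽)
  (E : Type*) [MetricSpace E] [AddCommGroup E] [Module 𝔽 E]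

/-- `U_FM(T, E)`: the frequently universal generalized harmonic functions. -/
def freqUniversal : Set (harmonic G w E) :=
  {f | ∀ V : Set (L0 Q E), IsOpen V → V.Nonempty →
    0 < lowerDensity {n | omega Q n (f : T → E) ∈ V}}

/-- `X(T, E)`: the generalized harmonic functions all of whose visiting sets have upper
density `1`. -/
def fullUpperDensity : Set (harmonic G w E) :=
  {f | ∀ V : Set (L0 Q E), IsOpen V → V.Nonempty →
    upperDensity {n | omega Q n (f : T → E) ∈ V} = 1}

end Universal

end TreeHarmonic

end

/-! A harmonic function can be prescribed freely at all children of a vertex but one: as `w` does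
not vanish on edges, the last value is solved for. Let this last child be the lightest one for `q`,
drawn with probability at most 1/2. If τ is harmonic at the levels strictly between n and m and f
equals τ at every non-lightest child of level in (n, m], then on a geodesic that avoids the lightest
child once between n and m, f equals τ from that step up to level m (`eq_of_notMem_minPath`). The
other geodesics have probability at most 2^-(m-n), so ω_m(f) is that close to ω_m(τ), whatever f is
up to level n. Hence the levels can be cut into blocks, each with its own target, and a given
harmonic g can be kept up to any level, which gives density.

For frequent universality, block j serves the code v = ν₂(j+1) and has length v+1. Long blocks are
rare enough that every code is served with positive lower density, and the error 2^-(v+1) beats the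
precision encoded in v. The target is placed at the last level of the block and averaged backwards.
For linear combinations, a sequence f_p is built over the same blocks: a block devoted to p gives
f_p its target and every other member the target 0, with the same exceptional geodesics. A
combination with a_p ≠ 0 then shows a_p times the target.

If the weights `w` sum to 1, a function of a fixed ancestor is harmonic, so a target can be held
throughout a block, and blocks of factorial growth give upper density 1. -/

namespace TreeHarmonic

/-! ### Parents and ancestors -/

section Tree

variable {T : Type*} (G : RootedTree T)

open Classical in
/-- The parent of a vertex; the root is its own parent. -/
noncomputable def RootedTree.parent (y : T) : T :=
  if h : y = G.root then G.root else (G.existsUnique_parent y h).choose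

variable {G}

theorem RootedTree.ne_root_of_mem_children {x y : T} (h : y ∈ G.children x) : y ≠ G.root := by
  intro h0
  have h1 := (G.level_eq_zero_iff y).2 h0
  have h2 := G.level_of_mem_children x y h
  omega

theorem RootedTree.parent_eq {x y : T} (h : y ∈ G.children x) : G.parent y = x := by
  have h0 := RootedTree.ne_root_of_mem_children h
  rw [RootedTree.parent, dif_neg h0]
  exact ((G.existsUnique_parent y h0).choose_spec.2 x h).symm

theorem RootedTree.mem_children_parent {y : T} (h : G.level y ≠ 0) :
    y ∈ G.children (G.parent y) := by
  have h0 : y ≠ G.root := fun h0 => h ((G.level_eq_zero_iff y).2 h0)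
  obtain ⟨x, hx, -⟩ := G.existsUnique_parent y h0
  rwa [RootedTree.parent_eq hx]

theorem RootedTree.level_parent {y : T} (h : G.level y ≠ 0) :
    G.level y = G.level (G.parent y) + 1 :=
  G.level_of_mem_children _ _ (RootedTree.mem_children_parent h)

variable (G) in
/-- The ancestor of `y` at level `k`, for `k ≤ level y`, and `y` itself for `level y ≤ k`. -/
noncomputable def RootedTree.ancestor (k : ℕ) (y : T) : T := G.parent^[G.level y - k] y

theorem RootedTree.Boundary.parent_vertex (e : G.Boundary) (n : ℕ) :
    G.parent (e.vertex (n + 1)) = e.vertex n :=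
  RootedTree.parent_eq (e.vertex_succ_mem n)

theorem RootedTree.Boundary.ancestor_vertex (e : G.Boundary) {k n : ℕ} (h : k ≤ n) :
    G.ancestor k (e.vertex n) = e.vertex k := by
  obtain ⟨i, rfl⟩ := Nat.exists_eq_add_of_le h
  rw [RootedTree.ancestor, e.level_vertex, Nat.add_sub_cancel_left]
  clear h
  induction i with
  | zero => rfl
  | succ i ih =>
    rw [Function.iterate_succ_apply, ← Nat.add_assoc, e.parent_vertex, ih]

theorem RootedTree.Boundary.vertex_eq_of_le {e e' : G.Boundary} {k n : ℕ} (h : k ≤ n)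
    (he : e.vertex n = e'.vertex n) : e.vertex k = e'.vertex k := by
  rw [← e.ancestor_vertex h, he, e'.ancestor_vertex h]

theorem RootedTree.ancestor_of_mem_children {x y : T} {k : ℕ} (h : y ∈ G.children x)
    (hk : k ≤ G.level x) : G.ancestor k y = G.ancestor k x := by
  rw [RootedTree.ancestor, RootedTree.ancestor, G.level_of_mem_children x y h, Nat.succ_sub hk,
    Function.iterate_succ_apply, RootedTree.parent_eq h]

theorem RootedTree.children_nonempty (x : T) : (G.children x).Nonempty :=
  Finset.card_pos.1 (lt_of_lt_of_le two_pos (G.two_le_card_children x))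

theorem RootedTree.pairwiseDisjoint_sector (G : RootedTree T) (m : ℕ) :
    {x | G.level x = m}.PairwiseDisjoint G.sector := by
  intro x hx y hy hxy
  refine Set.disjoint_left.2 fun e he he' => hxy ?_
  rw [RootedTree.mem_sector_iff] at he he'
  rw [← he, ← he', hx, hy]

end Tree

/-! ### Geodesics that always take the lightest child -/

section MinChild

variable {T : Type*} {G : RootedTree T} (Q : Weights G)

/-- A child of `x` of smallest weight. -/
noncomputable def Weights.minChild (x : T) : T :=
  ((G.children x).exists_min_image (Q.q x) (RootedTree.children_nonempty x)).choose

theorem Weights.minChild_mem (x : T) : Q.minChild x ∈ G.children x :=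
  ((G.children x).exists_min_image (Q.q x) (RootedTree.children_nonempty x)).choose_spec.1

theorem Weights.q_minChild_le (x : T) : Q.q x (Q.minChild x) ≤ 1 / 2 := by
  have hmin := ((G.children x).exists_min_image (Q.q x)
    (RootedTree.children_nonempty x)).choose_spec.2
  have h1 := Finset.card_nsmul_le_sum (G.children x) (Q.q x) (Q.q x (Q.minChild x)) hmin
  rw [Q.sum_eq_one, nsmul_eq_mul] at h1
  have h2 : (2 : ℝ) ≤ (G.children x).card := by exact_mod_cast G.two_le_card_children x
  have h3 := Q.nonneg x (Q.minChild x)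
  nlinarith

theorem Weights.boundaryMeasure_sector_minChild_le (x : T) :
    Q.boundaryMeasure (G.sector (Q.minChild x)) ≤ 2⁻¹ * Q.boundaryMeasure (G.sector x) := by
  by_cases hne : (G.sector (Q.minChild x)).Nonempty
  · obtain ⟨e, he⟩ := hne
    have hl := G.level_of_mem_children x _ (Q.minChild_mem x)
    rw [RootedTree.mem_sector_iff, hl] at he
    have hx : e.vertex (G.level x) = x := by
      rw [← e.parent_vertex, he, RootedTree.parent_eq (Q.minChild_mem x)]
    have h1 := Q.boundaryMeasure_sector e (G.level x + 1)
    have h2 := Q.boundaryMeasure_sector e (G.level x)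
    rw [Finset.prod_range_succ, ENNReal.ofReal_mul (Finset.prod_nonneg fun _ _ => Q.nonneg _ _),
      ← h2, he, hx, mul_comm] at h1
    rw [h1]
    gcongr
    refine (ENNReal.ofReal_le_ofReal (Q.q_minChild_le x)).trans_eq ?_
    rw [one_div, ENNReal.ofReal_inv_of_pos two_pos, ENNReal.ofReal_ofNat]
  · rw [Set.not_nonempty_iff_eq_empty.1 hne, measure_empty]
    exact zero_le

/-- The geodesics all of whose steps from level `n` to level `m` go to the child of smallest
weight. -/
noncomputable def Weights.minPath (n m : ℕ) : Set G.Boundary :=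
  {e | ∀ j, n ≤ j → j < m → e.vertex (j + 1) = Q.minChild (e.vertex j)}

/-- Membership is decided by the vertex at level m, so the set is a finite disjoint union of
sectors; one further forced step keeps at most half of the mass of each. -/
theorem Weights.boundaryMeasure_minPath_le (n i : ℕ) :
    Q.boundaryMeasure (Q.minPath n (n + i)) ≤ 2⁻¹ ^ i := by
  induction i with
  | zero => simpa using prob_le_one
  | succ i ih =>
    set m := n + i with hm
    have hfin : {x | ∃ e ∈ Q.minPath n m, e.vertex m = x}.Finite :=
      (G.finite_level m).subset fun x ⟨e, _, hx⟩ => by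
        rw [Set.mem_ofPred_eq, ← hx, e.level_vertex]
    set s := hfin.toFinset with hs
    have hsub : Q.minPath n (m + 1) ⊆ ⋃ x ∈ s, G.sector (Q.minChild x) := by
      intro e he
      simp only [hs, Set.mem_iUnion, Set.Finite.mem_toFinset, exists_prop]
      exact ⟨e.vertex m, ⟨e, fun j h1 h2 => he j h1 (by omega), rfl⟩,
        ⟨m + 1, he m (by omega) (by omega)⟩⟩
    have hsup : (⋃ x ∈ s, G.sector x) ⊆ Q.minPath n m := by
      intro e he
      simp only [hs, Set.mem_iUnion, Set.Finite.mem_toFinset, exists_prop] at he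
      obtain ⟨x, ⟨e', he', hx⟩, hex⟩ := he
      rw [RootedTree.mem_sector_iff, ← hx, e'.level_vertex] at hex
      intro j h1 h2
      rw [RootedTree.Boundary.vertex_eq_of_le h2 hex,
        RootedTree.Boundary.vertex_eq_of_le h2.le hex]
      exact he' j h1 h2
    calc Q.boundaryMeasure (Q.minPath n (m + 1))
        ≤ Q.boundaryMeasure (⋃ x ∈ s, G.sector (Q.minChild x)) := measure_mono hsub
      _ ≤ ∑ x ∈ s, Q.boundaryMeasure (G.sector (Q.minChild x)) := measure_biUnion_finset_le _ _
      _ ≤ ∑ x ∈ s, 2⁻¹ * Q.boundaryMeasure (G.sector x) :=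
        Finset.sum_le_sum fun x _ => Q.boundaryMeasure_sector_minChild_le x
      _ = 2⁻¹ * Q.boundaryMeasure (⋃ x ∈ s, G.sector x) := by
        rw [← Finset.mul_sum, measure_biUnion_finset _ fun x _ =>
          RootedTree.measurableSet_sector x]
        refine (G.pairwiseDisjoint_sector m).subset fun x hx => ?_
        obtain ⟨e, -, rfl⟩ := hfin.mem_toFinset.1 hx
        exact e.level_vertex m
      _ ≤ 2⁻¹ * 2⁻¹ ^ i := by gcongr; exact (measure_mono hsup).trans ih
      _ = 2⁻¹ ^ (i + 1) := by rw [pow_succ, mul_comm]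

theorem Weights.measurableSet_minPath (n m : ℕ) : MeasurableSet (Q.minPath n m) := by
  have := G.countable
  have h : Q.minPath n m = ⋂ j, ⋂ (_ : n ≤ j), ⋂ (_ : j < m),
      ⋃ x ∈ {x | G.level x = j}, G.sector (Q.minChild x) := by
    ext e
    simp only [Weights.minPath, Set.mem_ofPred_eq, Set.mem_iInter, Set.mem_iUnion, exists_prop]
    refine forall_congr' fun j => forall_congr' fun _ => forall_congr' fun _ => ⟨fun h => ?_, ?_⟩
    · exact ⟨e.vertex j, e.level_vertex j, j + 1, h⟩
    · rintro ⟨x, rfl, hx⟩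
      rw [RootedTree.mem_sector_iff, G.level_of_mem_children _ _ (Q.minChild_mem x)] at hx
      have h2 : e.vertex (G.level x) = x := by
        rw [← e.parent_vertex, hx, RootedTree.parent_eq (Q.minChild_mem x)]
      rw [hx, h2]
  rw [h]
  exact MeasurableSet.iInter fun j => MeasurableSet.iInter fun _ => MeasurableSet.iInter fun _ =>
    MeasurableSet.iUnion fun x => MeasurableSet.iUnion fun _ => RootedTree.measurableSet_sector _

variable {E : Type*} [MetricSpace E]

theorem dist_omega {n m : ℕ} (f g : T → E) :
    dist (omega Q n f) (omega Q m g) =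
      ∫ e, bdist (f (e.vertex n)) (g (e.vertex m)) ∂Q.boundaryMeasure := by
  refine integral_congr_ae ?_
  filter_upwards [AEEqFun.coeFn_mk _ (stronglyMeasurable_vertex f n).aestronglyMeasurable,
    AEEqFun.coeFn_mk _ (stronglyMeasurable_vertex g m).aestronglyMeasurable] with e h1 h2
  rw [omega, omega, h1, h2]

/-- `bdist` is at most 1, so the distance is at most the probability of the exceptional set. The
levels a and b may differ, which allows comparison with a target living at a lower level. -/
theorem dist_omega_le_of_eq_of_notMem_minPath {f g : T → E} {a b n i : ℕ}
    (h : ∀ e ∉ Q.minPath n (n + i), f (e.vertex a) = g (e.vertex b)) :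
    dist (omega Q a f) (omega Q b g) ≤ (1 / 2) ^ i := by
  rw [dist_omega]
  have hm := Q.measurableSet_minPath n (n + i)
  calc ∫ e, bdist (f (e.vertex a)) (g (e.vertex b)) ∂Q.boundaryMeasure
      ≤ ∫ e, (Q.minPath n (n + i)).indicator 1 e ∂Q.boundaryMeasure := by
        refine integral_mono_of_nonneg (Eventually.of_forall fun e => bdist_nonneg _ _)
          ((integrable_const 1).indicator hm) (Eventually.of_forall fun e => ?_)
        by_cases he : e ∈ Q.minPath n (n + i)
        · simpa [he] using bdist_le_one _ _
        · simp [he, bdist_eq_zero.2 (h e he)]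
    _ = Q.boundaryMeasure.real (Q.minPath n (n + i)) := integral_indicator_one hm
    _ ≤ (1 / 2) ^ i := by
      refine ENNReal.toReal_le_of_le_ofReal (by positivity)
        ((Q.boundaryMeasure_minPath_le n i).trans_eq ?_)
      rw [ENNReal.ofReal_pow (by positivity), one_div, ENNReal.ofReal_inv_of_pos two_pos,
        ENNReal.ofReal_ofNat]

end MinChild

/-! ### Harmonic extension with free values off the lightest children -/

section Extension

variable {T 𝔽 E : Type*} {G : RootedTree T} (Q : Weights G) [Field 𝔽] [AddCommGroup E]
  [Module 𝔽 E] (w : T → T → 𝔽)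

open Classical in
/-- The function that is `g` up to level `N`, and above it takes the values of `τ` at every vertex
that is not a child of smallest weight, and at the remaining vertices the value that makes it
harmonic at the parent. -/
noncomputable def harmonicExtension (g τ : T → E) (N : ℕ) (y : T) : E :=
  if _h : G.level y ≤ N then g y
  else if y = Q.minChild (G.parent y) then
    (w (G.parent y) y)⁻¹ • (harmonicExtension g τ N (G.parent y) -
      ∑ z ∈ (G.children (G.parent y)).erase y, w (G.parent y) z • τ z)
  else τ y
termination_by G.level y
decreasing_by
  have := RootedTree.level_parent (G := G) (y := y) (by omega)
  omega

theorem harmonicExtension_of_le (g τ : T → E) {N : ℕ} {y : T} (h : G.level y ≤ N) :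
    harmonicExtension Q w g τ N y = g y := by
  rw [harmonicExtension, dif_pos h]

theorem harmonicExtension_of_ne (g τ : T → E) {N : ℕ} {y : T} (h : N < G.level y)
    (hy : y ≠ Q.minChild (G.parent y)) : harmonicExtension Q w g τ N y = τ y := by
  rw [harmonicExtension, dif_neg h.not_ge, if_neg hy]

variable {w}

theorem harmonicExtension_mem (hw : ∀ x, ∀ y ∈ G.children x, w x y ≠ 0) {g : T → E}
    (hg : g ∈ harmonic G w E) (τ : T → E) (N : ℕ) :
    harmonicExtension Q w g τ N ∈ harmonic G w E := by
  classical
  intro x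
  -- Below level N all children still carry values of g; from level N on, the lightest child was
  -- defined to solve the equation.
  by_cases hx : G.level x < N
  · rw [harmonicExtension_of_le Q w g τ hx.le, hg x]
    refine Finset.sum_congr rfl fun y hy => ?_
    rw [harmonicExtension_of_le]
    rw [G.level_of_mem_children x y hy]
    omega
  · have hm := Q.minChild_mem x
    have hp := RootedTree.parent_eq hm
    have h1 : ∀ y ∈ (G.children x).erase (Q.minChild x),
        w x y • harmonicExtension Q w g τ N y = w x y • τ y := by
      intro y hy
      rw [Finset.mem_erase] at hy
      rw [harmonicExtension_of_ne]
      · rw [G.level_of_mem_children x y hy.2]; omega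
      · rw [RootedTree.parent_eq hy.2]
        exact hy.1
    have h2 : w x (Q.minChild x) • harmonicExtension Q w g τ N (Q.minChild x) =
        harmonicExtension Q w g τ N x -
          ∑ z ∈ (G.children x).erase (Q.minChild x), w x z • τ z := by
      have hl : ¬ G.level (Q.minChild x) ≤ N := by
        rw [G.level_of_mem_children x _ hm]; omega
      rw [harmonicExtension, dif_neg hl, hp, if_pos rfl, smul_inv_smul₀ (hw x _ hm)]
    rw [← Finset.add_sum_erase _ _ hm, Finset.sum_congr rfl h1, h2, sub_add_cancel]

/-- Once f and τ agree at a vertex of the geodesic, they agree at its non-lightest children by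
assumption, and the two harmonic equations then force agreement at the lightest child, whose
coefficient is nonzero. -/
theorem eq_of_notMem_minPath (hw : ∀ x, ∀ y ∈ G.children x, w x y ≠ 0) {f τ : T → E}
    (hf : f ∈ harmonic G w E) {n m : ℕ}
    (hfτ : ∀ y, n < G.level y → G.level y ≤ m → y ≠ Q.minChild (G.parent y) → f y = τ y)
    (hτ : ∀ x, n < G.level x → G.level x < m → τ x = ∑ y ∈ G.children x, w x y • τ y)
    {e : G.Boundary} (he : e ∉ Q.minPath n m) : f (e.vertex m) = τ (e.vertex m) := by
  classical
  simp only [Weights.minPath, Set.mem_ofPred_eq, not_forall, exists_prop] at he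
  obtain ⟨j, hnj, hjm, hj⟩ := he
  have key : ∀ i, j + 1 + i ≤ m → f (e.vertex (j + 1 + i)) = τ (e.vertex (j + 1 + i)) := by
    intro i
    induction i with
    | zero =>
      intro _
      refine hfτ _ ?_ ?_ ?_
      · rw [e.level_vertex]; omega
      · rw [e.level_vertex]; omega
      · rwa [Nat.add_zero, e.parent_vertex]
    | succ i ih =>
      intro hi
      set x := e.vertex (j + 1 + i) with hx
      have hlx : G.level x = j + 1 + i := e.level_vertex _
      have hmem : e.vertex (j + 1 + (i + 1)) ∈ G.children x := e.vertex_succ_mem _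
      have hoth : ∀ y ∈ G.children x, y ≠ Q.minChild x → f y = τ y := by
        intro y hy hne
        have hl := G.level_of_mem_children x y hy
        refine hfτ y (by omega) (by omega) ?_
        rwa [RootedTree.parent_eq hy]
      by_cases hy : e.vertex (j + 1 + (i + 1)) = Q.minChild x
      · have h1 := ih (by omega)
        rw [hf x, hτ x (by omega) (by omega), ← Finset.add_sum_erase _ _ hmem,
          ← Finset.add_sum_erase _ (fun y => w x y • τ y) hmem] at h1
        have h2 : ∀ y ∈ (G.children x).erase (e.vertex (j + 1 + (i + 1))),
            w x y • f y = w x y • τ y := by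
          intro y hy'
          rw [Finset.mem_erase] at hy'
          rw [hoth y hy'.2 (hy ▸ hy'.1)]
        rw [Finset.sum_congr rfl h2, add_left_inj] at h1
        rw [← inv_smul_smul₀ (hw x _ hmem) (f _), h1, inv_smul_smul₀ (hw x _ hmem)]
      · exact hoth _ hmem hy
  have := key (m - (j + 1)) (by omega)
  rwa [show j + 1 + (m - (j + 1)) = m by omega] at this

end Extension

/-! ### Prescribing a target on each block of levels -/

section Blocks

/-- For strictly increasing `c`, the index `j` of the block `(c j, c (j + 1)]` that contains `n`. -/
noncomputable def blockIndex (c : ℕ → ℕ) (n : ℕ) : ℕ := sInf {j | n ≤ c (j + 1)}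

theorem blockIndex_eq {c : ℕ → ℕ} (hc : StrictMono c) {j n : ℕ} (h1 : c j < n)
    (h2 : n ≤ c (j + 1)) : blockIndex c n = j := by
  refine le_antisymm (Nat.sInf_le h2) (le_csInf ⟨j, h2⟩ fun i hi => ?_)
  by_contra! hij
  have h3 : c (i + 1) ≤ c j := hc.monotone hij
  have h4 : n ≤ c (i + 1) := hi
  omega

variable {T 𝔽 E : Type*} {G : RootedTree T} (Q : Weights G) [Field 𝔽] [AddCommGroup E]
  [Module 𝔽 E] {w : T → T → 𝔽}

theorem exists_harmonic_eq_of_notMem_minPath (hw : ∀ x, ∀ y ∈ G.children x, w x y ≠ 0)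
    {c : ℕ → ℕ} (hc : StrictMono c) (H : ℕ → T → E) {g : T → E} (hg : g ∈ harmonic G w E)
    (N : ℕ) :
    ∃ f ∈ harmonic G w E, (∀ y, G.level y ≤ N → f y = g y) ∧ ∀ j, N ≤ c j →
      ∀ e ∉ Q.minPath (c j) (c (j + 1)), f (e.vertex (c (j + 1))) = H j (e.vertex (c (j + 1))) := by
  -- Iterating the averaging operator backwards from `H j` makes τ harmonic strictly inside the
  -- block, while the zeroth iterate leaves `H j` itself at its last level.
  let A : (T → E) → T → E := fun h x => ∑ y ∈ G.children x, w x y • h y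
  let τ : T → E := fun y => A^[c (blockIndex c (G.level y) + 1) - G.level y]
    (H (blockIndex c (G.level y))) y
  have hτ : ∀ j y, c j < G.level y → G.level y ≤ c (j + 1) →
      τ y = A^[c (j + 1) - G.level y] (H j) y := by
    intro j y h1 h2
    simp only [τ, blockIndex_eq hc h1 h2]
  refine ⟨harmonicExtension Q w g τ N, harmonicExtension_mem Q hw hg τ N,
    fun y hy => harmonicExtension_of_le Q w g τ hy, fun j hj e he => ?_⟩
  rw [eq_of_notMem_minPath Q hw (harmonicExtension_mem Q hw hg τ N)
    (fun y h1 _ h3 => harmonicExtension_of_ne Q w g τ (hj.trans_lt h1) h3) ?_ he,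
    hτ j _ (by rw [e.level_vertex]; exact hc (Nat.lt_succ_self j)) (e.level_vertex _).le,
    e.level_vertex, Nat.sub_self, Function.iterate_zero_apply]
  intro x h1 h2
  rw [hτ j x h1 h2.le, show c (j + 1) - G.level x = (c (j + 1) - (G.level x + 1)) + 1 by omega,
    Function.iterate_succ_apply']
  refine Finset.sum_congr rfl fun y hy => ?_
  have hl := G.level_of_mem_children x y hy
  rw [hτ j y (by omega) (by omega), hl]

/-- Inside a block τ depends only on the ancestor at level `K j`, so it is constant on the children
of a vertex, with the value at that vertex; weights of sum 1 make it harmonic. Hence every level m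
of the block is controlled, not only the last. -/
theorem exists_harmonic_eq_ancestor_of_notMem_minPath
    (hw : ∀ x, ∀ y ∈ G.children x, w x y ≠ 0) (hw1 : ∀ x, ∑ y ∈ G.children x, w x y = 1)
    {c : ℕ → ℕ} (hc : StrictMono c) (φ : ℕ → T → E) (K : ℕ → ℕ) {g : T → E}
    (hg : g ∈ harmonic G w E) (N : ℕ) :
    ∃ f ∈ harmonic G w E, (∀ y, G.level y ≤ N → f y = g y) ∧ ∀ j, N ≤ c j → K j ≤ c j →
      ∀ m, c j < m → m ≤ c (j + 1) → ∀ e ∉ Q.minPath (c j) m,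
        f (e.vertex m) = φ j (e.vertex (K j)) := by
  let τ : T → E := fun y => φ (blockIndex c (G.level y))
    (G.ancestor (K (blockIndex c (G.level y))) y)
  have hτ : ∀ j y, c j < G.level y → G.level y ≤ c (j + 1) →
      τ y = φ j (G.ancestor (K j) y) := by
    intro j y h1 h2
    simp only [τ, blockIndex_eq hc h1 h2]
  refine ⟨harmonicExtension Q w g τ N, harmonicExtension_mem Q hw hg τ N,
    fun y hy => harmonicExtension_of_le Q w g τ hy, fun j hj hK m h1 h2 e he => ?_⟩
  rw [eq_of_notMem_minPath Q hw (harmonicExtension_mem Q hw hg τ N)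
    (fun y h1 _ h3 => harmonicExtension_of_ne Q w g τ (hj.trans_lt h1) h3) ?_ he,
    hτ j _ (by rwa [e.level_vertex]) (by rwa [e.level_vertex]), e.ancestor_vertex (by omega)]
  intro x h3 h4
  have h5 : ∀ y ∈ G.children x, w x y • τ y = w x y • τ x := by
    intro y hy
    have hl := G.level_of_mem_children x y hy
    rw [hτ j y (by omega) (by omega), hτ j x h3 (by omega),
      RootedTree.ancestor_of_mem_children hy (by omega)]
  rw [Finset.sum_congr rfl h5, ← Finset.sum_smul, hw1, one_smul]

end Blocks

/-! ### Lower and upper densities; ruler and factorial blocks -/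

section Density

theorem ncard_inter_Iic_div_le_one (A : Set ℕ) (n : ℕ) :
    ((A ∩ Set.Iic n).ncard : ℝ) / (n + 1) ≤ 1 := by
  rw [div_le_one (by positivity)]
  have h := Set.ncard_le_ncard (Set.inter_subset_right (s := A)) (Set.finite_Iic n)
  have h2 : (Set.Iic n).ncard = n + 1 := by
    rw [← Finset.coe_Iic, Set.ncard_coe_finset, Nat.card_Iic]
  exact_mod_cast h.trans_eq h2

theorem isBoundedUnder_le_ncard_inter_Iic_div (A : Set ℕ) :
    IsBoundedUnder (· ≤ ·) atTop fun n : ℕ => ((A ∩ Set.Iic n).ncard : ℝ) / (n + 1) :=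
  isBoundedUnder_of ⟨1, ncard_inter_Iic_div_le_one A⟩

theorem isBoundedUnder_ge_ncard_inter_Iic_div (A : Set ℕ) :
    IsBoundedUnder (· ≥ ·) atTop fun n : ℕ => ((A ∩ Set.Iic n).ncard : ℝ) / (n + 1) :=
  isBoundedUnder_of ⟨0, fun n => by positivity⟩

theorem lowerDensity_pos {A : Set ℕ} {u : ℕ → ℕ} (hu : Function.Injective u) {C i₀ : ℕ}
    (hC : 0 < C) (hA : ∀ i, i₀ ≤ i → u i ∈ A) (hle : ∀ i, u i ≤ C * (i + 1)) :
    0 < lowerDensity A := by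
  have hC' : (0 : ℝ) < C := by exact_mod_cast hC
  refine lt_of_lt_of_le (b := 1 / (2 * (C : ℝ))) (by positivity) ?_
  refine le_liminf_of_le (isBoundedUnder_le_ncard_inter_Iic_div A).isCoboundedUnder_ge ?_
  -- At least n/C - i₀ visits occur up to n; the threshold on n lets half of the main term absorb i₀
  -- and the rounding.
  filter_upwards [eventually_ge_atTop (2 * C * (i₀ + 2))] with n hn
  have hsub : u '' (Finset.Ico i₀ (n / C) : Finset ℕ) ⊆ A ∩ Set.Iic n := by
    rintro _ ⟨i, hi, rfl⟩
    rw [Finset.coe_Ico, Set.mem_Ico] at hi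
    refine ⟨hA i hi.1, (hle i).trans ?_⟩
    exact (Nat.mul_le_mul_left C hi.2).trans (Nat.mul_div_le n C)
  have hcard := Set.ncard_le_ncard hsub ((Set.finite_Iic n).inter_of_right A)
  rw [Set.ncard_image_of_injective _ hu, Set.ncard_coe_finset, Nat.card_Ico] at hcard
  have h1 : n + 1 ≤ C * (n / C + 1) := by
    have := Nat.lt_mul_div_succ n hC
    omega
  have h2 : ((n / C : ℕ) : ℝ) ≤ (A ∩ Set.Iic n).ncard + i₀ := by
    exact_mod_cast Nat.sub_le_iff_le_add.1 hcard
  have h1' : (n : ℝ) + 1 ≤ C * (((n / C : ℕ) : ℝ) + 1) := by exact_mod_cast h1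
  have hn' : 2 * (C : ℝ) * (i₀ + 2) ≤ n := by exact_mod_cast hn
  rw [div_le_div_iff₀ (by positivity) (by positivity)]
  nlinarith

theorem upperDensity_eq_one_iff {A : Set ℕ} : upperDensity A = 1 ↔
    ∀ δ : ℝ, 0 < δ → ∃ᶠ n : ℕ in atTop, 1 - δ < ((A ∩ Set.Iic n).ncard : ℝ) / (n + 1) := by
  constructor
  · intro h δ hδ
    refine frequently_lt_of_lt_limsup
      (isBoundedUnder_ge_ncard_inter_Iic_div A).isCoboundedUnder_le ?_
    change 1 - δ < upperDensity A
    linarith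
  · intro h
    refine le_antisymm (limsup_le_of_le
      (isBoundedUnder_ge_ncard_inter_Iic_div A).isCoboundedUnder_le
      (Eventually.of_forall (ncard_inter_Iic_div_le_one A))) ?_
    refine le_of_forall_pos_sub_le fun δ hδ => ?_
    exact le_limsup_of_frequently_le ((h δ hδ).mono fun n hn => hn.le)
      (isBoundedUnder_le_ncard_inter_Iic_div A)

theorem upperDensity_eq_one_mono {A B : Set ℕ} (hAB : A ⊆ B) (hA : upperDensity A = 1) :
    upperDensity B = 1 := by
  refine upperDensity_eq_one_iff.2 fun δ hδ => (upperDensity_eq_one_iff.1 hA δ hδ).mono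
    fun n hn => hn.trans_le ?_
  gcongr
  exact (Set.finite_Iic n).inter_of_right B

theorem upperDensity_ne_one_of_disjoint {A B : Set ℕ} (hA : 0 < lowerDensity A)
    (hAB : Disjoint A B) : upperDensity B ≠ 1 := by
  intro hB
  have h1 : ∀ᶠ n : ℕ in atTop, lowerDensity A / 2 < ((A ∩ Set.Iic n).ncard : ℝ) / (n + 1) :=
    eventually_lt_of_lt_liminf (half_lt_self hA) (isBoundedUnder_ge_ncard_inter_Iic_div A)
  obtain ⟨n, h2, h3⟩ := ((upperDensity_eq_one_iff.1 hB _ (half_pos hA)).and_eventually h1).exists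
  have h4 := ncard_inter_Iic_div_le_one (A ∪ B) n
  rw [Set.union_inter_distrib_right, Set.ncard_union_eq (hAB.mono Set.inter_subset_left
    Set.inter_subset_left) ((Set.finite_Iic n).inter_of_right A)
    ((Set.finite_Iic n).inter_of_right B), Nat.cast_add, add_div] at h4
  linarith

theorem upperDensity_eq_one_of_factorial {A : Set ℕ} {r : ℕ}
    (h : ∃ᶠ j : ℕ in atTop, Set.Ioc ((j + 1).factorial + r) (j + 2).factorial ⊆ A) :
    upperDensity A = 1 := by
  refine upperDensity_eq_one_iff.2 fun δ hδ => ?_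
  -- At most (j+1)! + r + 1 ≤ 2 (j+1)! integers up to (j+2)! are missed, a proportion below 2/(j+2).
  obtain ⟨k, hk⟩ := exists_nat_gt (2 / δ)
  have htend : Tendsto (fun j : ℕ => (j + 2).factorial) atTop atTop :=
    tendsto_atTop_mono (fun j => (Nat.le_add_right j 2).trans (Nat.self_le_factorial _)) tendsto_id
  refine htend.frequently ((h.and_eventually (eventually_ge_atTop (max k r))).mono ?_)
  rintro j ⟨hj, hjk⟩
  have hsub : (Finset.Ioc ((j + 1).factorial + r) (j + 2).factorial : Set ℕ) ⊆
      A ∩ Set.Iic (j + 2).factorial := by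
    rw [Finset.coe_Ioc]
    exact fun i hi => ⟨hj hi, hi.2⟩
  have hcard := Set.ncard_le_ncard hsub ((Set.finite_Iic _).inter_of_right A)
  rw [Set.ncard_coe_finset, Nat.card_Ioc, Nat.sub_le_iff_le_add] at hcard
  have h1 : (((j + 2).factorial : ℕ) : ℝ) = (j + 2) * (j + 1).factorial := by
    rw [Nat.factorial_succ]; push_cast; ring
  have h2 : (r : ℝ) + 1 ≤ (j + 1).factorial := by
    have := Nat.self_le_factorial (j + 1)
    exact_mod_cast (by omega : r + 1 ≤ (j + 1).factorial)
  have h3 : (((j + 2).factorial : ℕ) : ℝ) ≤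
      (A ∩ Set.Iic (j + 2).factorial).ncard + ((j + 1).factorial + r) := by exact_mod_cast hcard
  have h4 : 2 < δ * (j + 2) := by
    rw [div_lt_iff₀ hδ] at hk
    have : (k : ℝ) ≤ j := by exact_mod_cast (le_max_left k r).trans hjk
    nlinarith
  rw [lt_div_iff₀ (by positivity)]
  have h5 : (0 : ℝ) ≤ r := Nat.cast_nonneg r
  rw [h1] at h3 ⊢
  nlinarith

/-- The end points of consecutive blocks, the `j`-th of which has length `1 + ν₂(j)`. -/
def rulerBlock (j : ℕ) : ℕ := j + padicValNat 2 j.factorial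

theorem rulerBlock_succ (j : ℕ) :
    rulerBlock (j + 1) = rulerBlock j + (padicValNat 2 (j + 1) + 1) := by
  rw [rulerBlock, rulerBlock, Nat.factorial_succ,
    padicValNat.mul (Nat.add_one_ne_zero j) j.factorial_ne_zero]
  omega

theorem strictMono_rulerBlock : StrictMono rulerBlock :=
  strictMono_nat_of_lt_succ fun j => by rw [rulerBlock_succ]; omega

/-- By Legendre's formula, ν₂(j!) is j minus the binary digit sum of j. -/
theorem rulerBlock_le (j : ℕ) : rulerBlock j ≤ 2 * j := by
  have := sub_one_mul_padicValNat_factorial (p := 2) j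
  rw [rulerBlock]
  omega

/-- The indices of valuation v are the numbers 2^v (2i+1), and their block end points grow linearly
in i. -/
theorem lowerDensity_pos_of_rulerBlock {A : Set ℕ} {v N : ℕ}
    (h : ∀ j, N ≤ rulerBlock j → padicValNat 2 (j + 1) = v → rulerBlock (j + 1) ∈ A) :
    0 < lowerDensity A := by
  have hpos : 0 < 2 ^ v := by positivity
  refine lowerDensity_pos (u := fun i => rulerBlock (2 ^ v * (2 * i + 1))) (C := 2 ^ v * 4)
    (i₀ := N) (strictMono_rulerBlock.injective.comp fun a b hab => ?_) (by positivity) ?_ ?_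
  · have := Nat.eq_of_mul_eq_mul_left hpos hab
    omega
  · intro i hi
    have h1 : 2 * i + 1 ≤ 2 ^ v * (2 * i + 1) := Nat.le_mul_of_pos_left _ hpos
    obtain ⟨j, hj⟩ : ∃ j, 2 ^ v * (2 * i + 1) = j + 1 := ⟨_, (Nat.succ_pred (by positivity)).symm⟩
    have h2 : j ≤ rulerBlock j := Nat.le_add_right _ _
    rw [hj]
    refine h j (by omega) ?_
    rw [← hj, padicValNat.mul (by positivity) (by omega), padicValNat.prime_pow,
      padicValNat.eq_zero_of_not_dvd (by omega), Nat.add_zero]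
  · intro i
    refine (rulerBlock_le _).trans ?_
    nlinarith

end Density

/-! ### Density in L⁰ of the functions of a single vertex -/

section Approximation

variable {T : Type*} {G : RootedTree T}

/-- Two cylinders can be read off at the larger of their levels through ancestors. As this algebra
generates the σ-algebra, it approximates every measurable set in measure. -/
theorem isSetAlgebra_cylinder (G : RootedTree T) :
    IsSetAlgebra {s : Set G.Boundary | ∃ (k : ℕ) (B : Set T), s = {e | e.vertex k ∈ B}} where
  empty_mem := ⟨0, ∅, by simp⟩
  compl_mem := by
    rintro _ ⟨k, B, rfl⟩
    exact ⟨k, Bᶜ, rfl⟩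
  union_mem := by
    rintro _ _ ⟨k, B, rfl⟩ ⟨l, C, rfl⟩
    refine ⟨max k l, G.ancestor k ⁻¹' B ∪ G.ancestor l ⁻¹' C, ?_⟩
    ext e
    simp only [Set.mem_union, Set.mem_ofPred_eq, Set.mem_preimage,
      e.ancestor_vertex (le_max_left k l), e.ancestor_vertex (le_max_right k l)]

theorem measurableSet_vertex_mem (k : ℕ) (B : Set T) :
    MeasurableSet {e : G.Boundary | e.vertex k ∈ B} := by
  have := G.countable
  have h : {e : G.Boundary | e.vertex k ∈ B} = ⋃ x ∈ {x ∈ B | G.level x = k}, G.sector x := by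
    ext e
    simp only [Set.mem_ofPred_eq, Set.mem_iUnion, exists_prop]
    constructor
    · exact fun he => ⟨e.vertex k, ⟨he, e.level_vertex k⟩, k, rfl⟩
    · rintro ⟨x, ⟨hx, rfl⟩, he⟩
      rw [RootedTree.mem_sector_iff] at he
      rwa [he]
  rw [h]
  exact MeasurableSet.biUnion (Set.to_countable _) fun x _ => RootedTree.measurableSet_sector x

theorem generateFrom_cylinder : (inferInstance : MeasurableSpace G.Boundary) =
    MeasurableSpace.generateFrom
      {s : Set G.Boundary | ∃ (k : ℕ) (B : Set T), s = {e | e.vertex k ∈ B}} := by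
  refine le_antisymm (MeasurableSpace.generateFrom_mono ?_) (MeasurableSpace.generateFrom_le ?_)
  · rintro _ ⟨x, rfl⟩
    refine ⟨G.level x, {x}, ?_⟩
    ext e
    exact RootedTree.mem_sector_iff
  · rintro _ ⟨k, B, rfl⟩
    exact measurableSet_vertex_mem k B

theorem exists_cylinder_approx (Q : Weights G) {s : Set G.Boundary} (hs : MeasurableSet s) {ε : ℝ}
    (hε : 0 < ε) : ∃ (k : ℕ) (B : Set T),
      Q.boundaryMeasure.real (symmDiff s {e | e.vertex k ∈ B}) < ε := by
  obtain ⟨_, ⟨k, B, rfl⟩, h⟩ := (Measure.MeasureDense.of_generateFrom_isSetAlgebra_finite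
    Q.boundaryMeasure (isSetAlgebra_cylinder G) generateFrom_cylinder).approx s hs
    (measure_ne_top _ _) ε hε
  exact ⟨k, B, (ENNReal.lt_ofReal_iff_toReal_lt (measure_ne_top _ _)).1 h⟩

variable {E : Type*} [MetricSpace E] (Q : Weights G)

theorem continuous_bdist : Continuous fun p : E × E => bdist p.1 p.2 := by
  unfold bdist
  refine Continuous.div (by fun_prop) (by fun_prop) fun p => ?_
  positivity

theorem integrable_bdist_of_stronglyMeasurable {h g : G.Boundary → E} (hh : StronglyMeasurable h)
    (hg : StronglyMeasurable g) : Integrable (fun e => bdist (h e) (g e)) Q.boundaryMeasure := by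
  refine Integrable.of_bound (continuous_bdist.comp_aestronglyMeasurable
    (hh.aestronglyMeasurable.prodMk hg.aestronglyMeasurable)) 1 (Eventually.of_forall fun e => ?_)
  rw [Real.norm_of_nonneg (bdist_nonneg _ _)]
  exact bdist_le_one _ _

theorem exists_integral_bdist_lt_of_simpleFunc [Nonempty E] (h : SimpleFunc G.Boundary E) :
    ∀ ε : ℝ, 0 < ε → ∃ (k : ℕ) (φ : T → E),
      ∫ e, bdist (h e) (φ (e.vertex k)) ∂Q.boundaryMeasure < ε := by
  classical
  induction h using SimpleFunc.induction' with
  | const c => exact fun ε hε => ⟨0, fun _ => c, by simpa [bdist_eq_zero.2 rfl] using hε⟩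
  | @pcw f g s hs hf hg =>
    intro ε hε
    obtain ⟨k, φ, hφ⟩ := hf (ε / 3) (by positivity)
    obtain ⟨l, ψ, hψ⟩ := hg (ε / 3) (by positivity)
    -- Replacing s by a cylinder costs at most the measure of the symmetric difference, since
    -- `bdist` is at most 1.
    obtain ⟨m, B, hB⟩ := exists_cylinder_approx Q hs (ε := ε / 3) (by positivity)
    set D := symmDiff s {e : G.Boundary | e.vertex m ∈ B} with hD
    have hDm : MeasurableSet D := hs.symmDiff (measurableSet_vertex_mem m B)
    let n := max (max k l) m
    let χ : T → E := fun y => if G.ancestor m y ∈ B then φ (G.ancestor k y) else ψ (G.ancestor l y)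
    have hχ : ∀ e : G.Boundary, χ (e.vertex n) =
        if e.vertex m ∈ B then φ (e.vertex k) else ψ (e.vertex l) := by
      intro e
      simp only [χ, e.ancestor_vertex (show m ≤ n from le_max_right _ _),
        e.ancestor_vertex (show k ≤ n from (le_max_left _ _).trans (le_max_left _ _)),
        e.ancestor_vertex (show l ≤ n from (le_max_right _ _).trans (le_max_left _ _))]
    have i1 := integrable_bdist_of_stronglyMeasurable Q f.stronglyMeasurable
      (stronglyMeasurable_vertex φ k)
    have i2 := integrable_bdist_of_stronglyMeasurable Q g.stronglyMeasurable
      (stronglyMeasurable_vertex ψ l)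
    have i3 : Integrable (D.indicator 1) Q.boundaryMeasure :=
      (integrable_const (1 : ℝ)).indicator hDm
    refine ⟨n, χ, lt_of_le_of_lt (b := ∫ e, (bdist (f e) (φ (e.vertex k)) +
      bdist (g e) (ψ (e.vertex l)) + D.indicator 1 e) ∂Q.boundaryMeasure) ?_ ?_⟩
    · refine integral_mono_of_nonneg (Eventually.of_forall fun e => bdist_nonneg _ _)
        ((i1.add i2).add i3) (Eventually.of_forall fun e => ?_)
      beta_reduce
      rw [hχ, SimpleFunc.piecewise_apply]
      have b1 := bdist_nonneg (f e) (φ (e.vertex k))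
      have b2 := bdist_nonneg (g e) (ψ (e.vertex l))
      by_cases h1 : e ∈ s <;> by_cases h2 : e.vertex m ∈ B
      · rw [if_pos h1, if_pos h2]
        have : (0 : ℝ) ≤ D.indicator 1 e := Set.indicator_nonneg (fun _ _ => zero_le_one) e
        linarith
      · rw [Set.indicator_of_mem (show e ∈ D from Or.inl ⟨h1, h2⟩), Pi.one_apply]
        linarith [bdist_le_one (if e ∈ s then f e else g e)
          (if e.vertex m ∈ B then φ (e.vertex k) else ψ (e.vertex l))]
      · rw [Set.indicator_of_mem (show e ∈ D from Or.inr ⟨h2, h1⟩), Pi.one_apply]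
        linarith [bdist_le_one (if e ∈ s then f e else g e)
          (if e.vertex m ∈ B then φ (e.vertex k) else ψ (e.vertex l))]
      · rw [if_neg h1, if_neg h2]
        have : (0 : ℝ) ≤ D.indicator 1 e := Set.indicator_nonneg (fun _ _ => zero_le_one) e
        linarith
    · have h1 := integral_add (i1.add i2) i3
      have h2 := integral_add i1 i2
      have h3 := integral_indicator_one (μ := Q.boundaryMeasure) hDm
      simp only [Pi.add_apply] at h1
      linarith

theorem exists_integral_bdist_lt [Nonempty E] {h : G.Boundary → E} (hh : StronglyMeasurable h)
    {ε : ℝ} (hε : 0 < ε) : ∃ (k : ℕ) (φ : T → E),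
      ∫ e, bdist (h e) (φ (e.vertex k)) ∂Q.boundaryMeasure < ε := by
  have htend : Tendsto (fun n => ∫ e, bdist (h e) (hh.approx n e) ∂Q.boundaryMeasure) atTop
      (𝓝 (∫ _, (0 : ℝ) ∂Q.boundaryMeasure)) := by
    refine tendsto_integral_of_dominated_convergence (fun _ => 1) (fun n =>
      (integrable_bdist_of_stronglyMeasurable Q hh (hh.approx n).stronglyMeasurable).1)
      (integrable_const 1) (fun n => Eventually.of_forall fun e => ?_)
      (Eventually.of_forall fun e => ?_)
    · rw [Real.norm_of_nonneg (bdist_nonneg _ _)]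
      exact bdist_le_one _ _
    · have h1 : Tendsto (fun n => (h e, hh.approx n e)) atTop (𝓝 (h e, h e)) :=
        tendsto_const_nhds.prodMk_nhds (hh.tendsto_approx e)
      have h2 := (continuous_bdist.tendsto (h e, h e)).comp h1
      rwa [bdist_eq_zero.2 rfl] at h2
  rw [integral_zero] at htend
  obtain ⟨n, hn⟩ := (htend.eventually (gt_mem_nhds (half_pos hε))).exists
  obtain ⟨k, φ, hφ⟩ := exists_integral_bdist_lt_of_simpleFunc Q (hh.approx n) _ (half_pos hε)
  refine ⟨k, φ, ?_⟩
  have i1 := integrable_bdist_of_stronglyMeasurable Q hh (hh.approx n).stronglyMeasurable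
  have i2 := integrable_bdist_of_stronglyMeasurable Q (hh.approx n).stronglyMeasurable
    (stronglyMeasurable_vertex φ k)
  have h1 := integral_mono
    (integrable_bdist_of_stronglyMeasurable Q hh (stronglyMeasurable_vertex φ k)) (i1.add i2)
    fun e => bdist_triangle (h e) (hh.approx n e) (φ (e.vertex k))
  have h2 := integral_add i1 i2
  simp only [Pi.add_apply] at h1
  linarith

theorem exists_dist_omega_lt [Nonempty E] (h : L0 Q E) {ε : ℝ} (hε : 0 < ε) :
    ∃ (k : ℕ) (φ : T → E), dist h (omega Q k φ) < ε := by
  obtain ⟨k, φ, hφ⟩ := exists_integral_bdist_lt Q h.stronglyMeasurable hε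
  refine ⟨k, φ, lt_of_eq_of_lt (integral_congr_ae ?_) hφ⟩
  filter_upwards [AEEqFun.coeFn_mk _ (stronglyMeasurable_vertex φ k).aestronglyMeasurable] with e h1
  rw [omega, h1]

/-- Only the finitely many vertices of level k matter, so pointwise closeness is uniform there. -/
theorem continuous_omega (k : ℕ) : Continuous fun f : T → E => omega Q k f := by
  refine continuous_iff_continuousAt.2 fun f₀ => Metric.tendsto_nhds.2 fun ε hε => ?_
  have h1 : ∀ᶠ f in 𝓝 f₀, ∀ x ∈ {x | G.level x = k}, dist (f x) (f₀ x) < ε / 2 :=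
    (Filter.eventually_all_finite (G.finite_level k)).2 fun x _ =>
      Metric.tendsto_nhds.1 ((continuous_apply x).tendsto f₀) _ (half_pos hε)
  filter_upwards [h1] with f hf
  rw [dist_omega]
  refine lt_of_le_of_lt ?_ (half_lt_self hε)
  calc ∫ e, bdist (f (e.vertex k)) (f₀ (e.vertex k)) ∂Q.boundaryMeasure
      ≤ ∫ _, ε / 2 ∂Q.boundaryMeasure := by
        refine integral_mono_of_nonneg (Eventually.of_forall fun e => bdist_nonneg _ _)
          (integrable_const _) (Eventually.of_forall fun e => ?_)
        refine le_trans ?_ (hf _ (e.level_vertex k)).le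
        exact div_le_self dist_nonneg (le_add_of_nonneg_right dist_nonneg)
    _ = ε / 2 := by simp

theorem exists_omega_mem_of_denseRange [Nonempty E] {ι : Type*} {φ : ι → T → E}
    (hφ : DenseRange φ) {V : Set (L0 Q E)} (hV : IsOpen V) (hne : V.Nonempty) :
    ∃ k i, omega Q k (φ i) ∈ V := by
  obtain ⟨h, hh⟩ := hne
  obtain ⟨ε, hε, hball⟩ := Metric.isOpen_iff.1 hV h hh
  obtain ⟨k, ψ, hψ⟩ := exists_dist_omega_lt Q h hε
  obtain ⟨i, hi⟩ := hφ.exists_mem_open (hV.preimage (continuous_omega Q k))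
    ⟨ψ, hball (by rwa [Metric.mem_ball, dist_comm])⟩
  exact ⟨k, i, hi⟩

end Approximation

/-! ### Dense families of universal harmonic functions -/

variable {T 𝔽 E : Type*} {G : RootedTree T} (Q : Weights G) [Field 𝔽] [AddCommGroup E]
  [Module 𝔽 E] [MetricSpace E] {w : T → T → 𝔽}

theorem mem_closure_of_forall_eq_of_level_le {S : Set (harmonic G w E)} (g : harmonic G w E)
    (h : ∀ N, ∃ f ∈ S, ∀ y, G.level y ≤ N → (f : T → E) y = (g : T → E) y) : g ∈ closure S := by
  choose f hfS hf using h
  refine mem_closure_of_tendsto (f := f) (b := atTop) ?_ (Eventually.of_forall hfS)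
  refine tendsto_subtype_rng.2 (tendsto_pi_nhds.2 fun y => ?_)
  refine tendsto_const_nhds.congr' ?_
  filter_upwards [eventually_ge_atTop (G.level y)] with N hN
  exact (hf N y hN).symm

theorem exists_denseRange_linearCombination_mem_freqUniversal
    [TopologicalSpace.SeparableSpace E] [ContinuousConstSMul 𝔽 E]
    (hw : ∀ x, ∀ y ∈ G.children x, w x y ≠ 0) :
    ∃ F : ℕ → harmonic G w E, DenseRange F ∧
      ∀ a : ℕ →₀ 𝔽, a ≠ 0 → Finsupp.linearCombination 𝔽 F a ∈ freqUniversal Q w E := by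
  classical
  have := G.countable
  have := UniformSpace.secondCountable_of_separable E
  have : SecondCountableTopology (harmonic G w E) :=
    Topology.IsInducing.subtypeVal.secondCountableTopology
  let φ := TopologicalSpace.denseSeq (T → E)
  let g := TopologicalSpace.denseSeq (harmonic G w E)
  -- a code `v` stands for a member of the family, a level, a target and a precision
  let H : ℕ → ℕ → T → E := fun p j y =>
    let v := (padicValNat 2 (j + 1)).unpair.1
    if v.unpair.1 = p then φ v.unpair.2.unpair.2 (G.ancestor v.unpair.2.unpair.1 y) else 0
  -- The index p encodes which dense element is copied and up to which level.
  choose f hf hfg hfH using fun p : ℕ => exists_harmonic_eq_of_notMem_minPath Q hw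
    strictMono_rulerBlock (H p) (g p.unpair.1).2 p.unpair.2
  refine ⟨fun p => ⟨f p, hf p⟩, ?_, fun a ha V hV hne => ?_⟩
  · refine Dense.of_closure ((TopologicalSpace.denseRange_denseSeq (harmonic G w E)).mono ?_)
    rintro _ ⟨i, rfl⟩
    refine mem_closure_of_forall_eq_of_level_le _ fun N => ⟨_, ⟨Nat.pair i N, rfl⟩, fun y hy => ?_⟩
    have := hfg (Nat.pair i N) y (by simpa using hy)
    rwa [Nat.unpair_pair] at this
  · obtain ⟨p, hp⟩ : ∃ p, a p ≠ 0 := by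
      by_contra! h
      exact ha (Finsupp.ext h)
    obtain ⟨h, hh⟩ := hne
    obtain ⟨ε, hε, hball⟩ := Metric.isOpen_iff.1 hV h hh
    -- The combination will show `a p • φ s`; scaling by a nonzero scalar is a homeomorphism, so
    -- these targets are still dense.
    have hdense : DenseRange fun s => a p • φ s :=
      (Homeomorph.smulOfNeZero (a p) hp).surjective.denseRange.comp
        (TopologicalSpace.denseRange_denseSeq (T → E)) (Homeomorph.smulOfNeZero (a p) hp).continuous
    obtain ⟨k, s, hks⟩ := exists_omega_mem_of_denseRange Q hdense (Metric.isOpen_ball (x := h))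
      ⟨h, Metric.mem_ball_self (half_pos hε)⟩
    obtain ⟨r, hr⟩ := exists_pow_lt_of_lt_one (half_pos hε) (one_half_lt_one (α := ℝ))
    -- Past this N, level k is already reached and no member of the finite support is still copying
    -- its dense element.
    refine lowerDensity_pos_of_rulerBlock (v := Nat.pair (Nat.pair p (Nat.pair k s)) r)
      (N := max k (a.support.sup fun p => p.unpair.2)) fun j hj hv => hball ?_
    set v := Nat.pair (Nat.pair p (Nat.pair k s)) r with hvdef
    have hlen := rulerBlock_succ j
    rw [hv] at hlen
    have key : ∀ e ∉ Q.minPath (rulerBlock j) (rulerBlock j + (v + 1)),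
        (Finsupp.linearCombination 𝔽 (fun p => (⟨f p, hf p⟩ : harmonic G w E)) a : T → E)
          (e.vertex (rulerBlock (j + 1))) = (a p • φ s) (e.vertex k) := by
      intro e he
      rw [← hlen] at he
      have h1 : ∀ p' ∈ a.support, a p' • f p' (e.vertex (rulerBlock (j + 1))) =
          if p = p' then a p • φ s (e.vertex k) else 0 := by
        intro p' hp'
        have hN : p'.unpair.2 ≤ rulerBlock j :=
          (Finset.le_sup (f := fun p : ℕ => p.unpair.2) hp').trans ((le_max_right _ _).trans hj)
        rw [hfH p' j hN e he]
        simp only [H, hv, hvdef, Nat.unpair_pair]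
        rw [e.ancestor_vertex (((le_max_left _ _).trans hj).trans (by omega))]
        split_ifs with hpp
        · rw [hpp]
        · rw [smul_zero]
      rw [Finsupp.linearCombination_apply, Finsupp.sum, Submodule.coe_sum, Finset.sum_apply]
      simp only [Submodule.coe_smul, Pi.smul_apply]
      rw [Finset.sum_congr rfl h1, Finset.sum_ite_eq, if_pos (Finsupp.mem_support_iff.2 hp)]
    have h2 := dist_omega_le_of_eq_of_notMem_minPath Q key
    -- The pairing function dominates its entries, so r ≤ v.
    have h3 : (1 / 2 : ℝ) ^ (v + 1) ≤ (1 / 2) ^ r :=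
      pow_le_pow_of_le_one (by norm_num) (by norm_num)
        ((Nat.right_le_pair _ _).trans (Nat.le_succ v))
    have h4 := dist_triangle
      (omega Q (rulerBlock (j + 1))
        (Finsupp.linearCombination 𝔽 (fun p => (⟨f p, hf p⟩ : harmonic G w E)) a : T → E))
      (omega Q k (a p • φ s)) h
    rw [Metric.mem_ball] at hks ⊢
    linarith

theorem dense_fullUpperDensity [TopologicalSpace.SeparableSpace E]
    (hw : ∀ x, ∀ y ∈ G.children x, w x y ≠ 0) (hw1 : ∀ x, ∑ y ∈ G.children x, w x y = 1) :
    Dense (fullUpperDensity Q w E) := by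
  have := G.countable
  let φ := TopologicalSpace.denseSeq (T → E)
  intro g
  refine mem_closure_of_forall_eq_of_level_le g fun N => ?_
  -- The shift by one avoids 0! = 1!.
  have hc : StrictMono fun j : ℕ => (j + 1).factorial :=
    strictMono_nat_of_lt_succ fun j => Nat.factorial_lt_of_lt (Nat.succ_pos j) (Nat.lt_succ_self _)
  obtain ⟨f, hf, hfg, hfφ⟩ := exists_harmonic_eq_ancestor_of_notMem_minPath Q hw hw1 hc
    (fun j => φ j.unpair.1.unpair.2) (fun j => j.unpair.1.unpair.1) g.2 N
  refine ⟨⟨f, hf⟩, fun V hV hne => ?_, hfg⟩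
  obtain ⟨h, hh⟩ := hne
  obtain ⟨ε, hε, hball⟩ := Metric.isOpen_iff.1 hV h hh
  obtain ⟨k, s, hks⟩ := exists_omega_mem_of_denseRange Q
    (TopologicalSpace.denseRange_denseSeq (T → E)) (Metric.isOpen_ball (x := h))
    ⟨h, Metric.mem_ball_self (half_pos hε)⟩
  obtain ⟨r, hr⟩ := exists_pow_lt_of_lt_one (half_pos hε) (one_half_lt_one (α := ℝ))
  refine upperDensity_eq_one_of_factorial (r := r) (frequently_atTop.2 fun M => ?_)
  -- The second entry of the code is a mere counter, so that each pair (k, s) is served in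
  -- infinitely many blocks.
  refine ⟨Nat.pair (Nat.pair k s) (max M N), ?_, ?_⟩
  · exact (le_max_left M N).trans (Nat.right_le_pair _ _)
  set j := Nat.pair (Nat.pair k s) (max M N) with hj
  rintro m ⟨hm1, hm2⟩
  have hjc : j + 1 ≤ (j + 1).factorial := Nat.self_le_factorial _
  have hNj : N ≤ j := (le_max_right M N).trans (Nat.right_le_pair _ _)
  have hkj : k ≤ j := (Nat.left_le_pair k s).trans (Nat.left_le_pair _ _)
  obtain ⟨i, rfl⟩ := Nat.exists_eq_add_of_lt hm1
  have key : ∀ e ∉ Q.minPath (j + 1).factorial ((j + 1).factorial + (r + i + 1)),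
      f (e.vertex ((j + 1).factorial + r + i + 1)) = φ s (e.vertex k) := by
    intro e he
    rw [← add_assoc, ← add_assoc] at he
    have hu : j.unpair.1 = Nat.pair k s := by rw [hj, Nat.unpair_pair]
    have h1 := hfφ j (by omega) (by rw [hu, Nat.unpair_pair]; omega) _ (by omega) hm2 e he
    rwa [hu, Nat.unpair_pair] at h1
  have h2 := dist_omega_le_of_eq_of_notMem_minPath Q key
  have h3 : (1 / 2 : ℝ) ^ (r + i + 1) ≤ (1 / 2) ^ r :=
    pow_le_pow_of_le_one (by norm_num) (by norm_num) (by omega)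
  have h4 := dist_triangle (omega Q ((j + 1).factorial + r + i + 1) f) (omega Q k (φ s)) h
  refine hball ?_
  rw [Metric.mem_ball] at hks ⊢
  linarith

/-! ### The G_δ property and disjointness -/

/-- The finitely many visits up to time n persist under small perturbations of f, so the count can
only grow locally. -/
theorem isOpen_setOf_lt_ncard_visits_div {V : Set (L0 Q E)} (hV : IsOpen V) (n : ℕ) (c : ℝ) :
    IsOpen {f : harmonic G w E |
      c < (({m | omega Q m (f : T → E) ∈ V} ∩ Set.Iic n).ncard : ℝ) / (n + 1)} := by
  refine isOpen_iff_mem_nhds.2 fun f₀ hf₀ => ?_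
  have h1 : ∀ᶠ f : harmonic G w E in 𝓝 f₀,
      ∀ m ∈ {m | omega Q m (f₀ : T → E) ∈ V} ∩ Set.Iic n, omega Q m (f : T → E) ∈ V := by
    refine (Filter.eventually_all_finite ((Set.finite_Iic n).inter_of_right _)).2 fun m hm => ?_
    exact ((continuous_omega Q m).comp continuous_subtype_val).continuousAt.eventually_mem
      (hV.mem_nhds hm.1)
  filter_upwards [h1] with f hf
  have h2 : {m | omega Q m (f₀ : T → E) ∈ V} ∩ Set.Iic n ⊆
      {m | omega Q m (f : T → E) ∈ V} ∩ Set.Iic n := fun m hm => ⟨hf m hm, hm.2⟩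
  refine lt_of_lt_of_le hf₀ (div_le_div_of_nonneg_right (Nat.cast_le.2 ?_) (by positivity))
  exact Set.ncard_le_ncard h2 ((Set.finite_Iic n).inter_of_right _)

/-- For countable ι this leaves countably many balls to test, as the G_δ property requires. -/
theorem mem_fullUpperDensity_iff [Nonempty E] {ι : Type*} {φ : ι → T → E} (hφ : DenseRange φ)
    {f : harmonic G w E} : f ∈ fullUpperDensity Q w E ↔ ∀ (k : ℕ) (i : ι) (p : ℕ),
      upperDensity {n | omega Q n (f : T → E) ∈
        Metric.ball (omega Q k (φ i)) (1 / ((p : ℝ) + 1))} = 1 := by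
  refine ⟨fun h k i p => h _ Metric.isOpen_ball
    ⟨_, Metric.mem_ball_self Nat.one_div_pos_of_nat⟩, fun h V hV hne => ?_⟩
  obtain ⟨x, hx⟩ := hne
  obtain ⟨ε, hε, hball⟩ := Metric.isOpen_iff.1 hV x hx
  obtain ⟨p, hp⟩ := exists_nat_one_div_lt (half_pos hε)
  obtain ⟨k, i, hki⟩ := exists_omega_mem_of_denseRange Q hφ
    (Metric.isOpen_ball (x := x) (ε := 1 / ((p : ℝ) + 1)))
    ⟨x, Metric.mem_ball_self Nat.one_div_pos_of_nat⟩
  refine upperDensity_eq_one_mono (fun n hn => hball ?_) (h k i p)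
  have h1 := dist_triangle (omega Q n (f : T → E)) (omega Q k (φ i)) x
  simp only [Set.mem_ofPred_eq, Metric.mem_ball] at hn hki ⊢
  linarith

theorem isGδ_fullUpperDensity [TopologicalSpace.SeparableSpace E] :
    IsGδ (fullUpperDensity Q w E) := by
  have := G.countable
  let φ := TopologicalSpace.denseSeq (T → E)
  have h : fullUpperDensity Q w E = ⋂ (k : ℕ) (i : ℕ) (p : ℕ) (q : ℕ) (N : ℕ),
      ⋃ (n : ℕ) (_ : N ≤ n), {f : harmonic G w E | 1 - 1 / ((q : ℝ) + 1) <
        (({m | omega Q m (f : T → E) ∈ Metric.ball (omega Q k (φ i)) (1 / ((p : ℝ) + 1))} ∩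
          Set.Iic n).ncard : ℝ) / (n + 1)} := by
    ext f
    rw [mem_fullUpperDensity_iff Q (TopologicalSpace.denseRange_denseSeq (T → E))]
    simp only [Set.mem_iInter, Set.mem_iUnion, exists_prop]
    refine forall_congr' fun k => forall_congr' fun i => forall_congr' fun p => ?_
    rw [upperDensity_eq_one_iff]
    constructor
    · exact fun h q N => frequently_atTop.1 (h _ Nat.one_div_pos_of_nat) N
    · intro h δ hδ
      obtain ⟨q, hq⟩ := exists_nat_one_div_lt hδ
      exact (frequently_atTop.2 (h q)).mono fun n hn => lt_trans (by linarith) hn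
  rw [h]
  refine IsGδ.iInter fun k => IsGδ.iInter fun i => IsGδ.iInter fun p => IsGδ.iInter fun q =>
    IsGδ.iInter_of_isOpen fun N => isOpen_iUnion fun n => isOpen_iUnion fun _ => ?_
  exact isOpen_setOf_lt_ncard_visits_div Q Metric.isOpen_ball n _

/-- Disjoint neighbourhoods of two distinct constants have disjoint visiting sets; positive lower
density of one keeps the upper density of the other below 1. -/
theorem disjoint_freqUniversal_fullUpperDensity [Nontrivial E] :
    Disjoint (freqUniversal Q w E) (fullUpperDensity Q w E) := by
  obtain ⟨a, b, hab⟩ := exists_pair_ne E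
  have hne : omega Q 0 (fun _ => a) ≠ omega Q 0 (fun _ => b) := by
    intro h
    have h1 := dist_omega (n := 0) (m := 0) Q (fun _ => a) (fun _ => b)
    rw [h, dist_self, integral_const, probReal_univ, one_smul] at h1
    exact hab (bdist_eq_zero.1 h1.symm)
  obtain ⟨U, V, hU, hV, haU, hbV, hUV⟩ := t2_separation hne
  refine Set.disjoint_left.2 fun f h1 h2 => ?_
  exact upperDensity_ne_one_of_disjoint (h1 U hU ⟨_, haU⟩)
    (Set.disjoint_left.2 fun n hn hn' => Set.disjoint_left.1 hUV hn hn') (h2 V hV ⟨_, hbV⟩)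

end TreeHarmonic

/-! ### The main theorem -/

theorem theorem3 {T 𝔽 E : Type*} (G : TreeHarmonic.RootedTree T) (Q : TreeHarmonic.Weights G)
    [Field 𝔽] [TopologicalSpace 𝔽]
    [AddCommGroup E] [Module 𝔽 E] [MetricSpace E] [TopologicalSpace.SeparableSpace E]
    [ContinuousSMul 𝔽 E] (hd : ∀ a b c : E, dist (a + c) (b + c) = dist a b)
    (w : T → T → 𝔽) (hw : ∀ x, ∀ y ∈ G.children x, w x y ≠ 0) :
    Dense (TreeHarmonic.freqUniversal Q w E) ∧
    ((∀ x, ∑ y ∈ G.children x, w x y = 1) →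
      (∃ W : Submodule 𝔽 (TreeHarmonic.harmonic G w E),
        (W : Set (TreeHarmonic.harmonic G w E)) ⊆ TreeHarmonic.freqUniversal Q w E ∪ {0} ∧
          Dense (W : Set (TreeHarmonic.harmonic G w E))) ∧
      IsGδ (TreeHarmonic.fullUpperDensity Q w E) ∧
      Dense (TreeHarmonic.fullUpperDensity Q w E) ∧
      (Nontrivial E →
        Disjoint (TreeHarmonic.freqUniversal Q w E) (TreeHarmonic.fullUpperDensity Q w E))) := by
  obtain ⟨F, hF, hcomb⟩ :=
    TreeHarmonic.exists_denseRange_linearCombination_mem_freqUniversal Q (E := E) hw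
  refine ⟨hF.mono ?_, fun hw1 => ⟨⟨Submodule.span 𝔽 (Set.range F), fun f hf => ?_,
    hF.mono Submodule.subset_span⟩, TreeHarmonic.isGδ_fullUpperDensity Q,
    TreeHarmonic.dense_fullUpperDensity Q hw hw1,
    fun _ => TreeHarmonic.disjoint_freqUniversal_fullUpperDensity Q⟩⟩
  · rintro _ ⟨p, rfl⟩
    have := hcomb (Finsupp.single p 1) (by simp)
    rwa [Finsupp.linearCombination_single, one_smul] at this
  · obtain ⟨a, rfl⟩ := (Finsupp.mem_span_range_iff_exists_finsupp (R := 𝔽)).1 hf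
    by_cases ha : a = 0
    · exact Or.inr (by simp [ha])
    · exact Or.inl (hcomb a ha)
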